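/- Let $T>0$ and $a\ge 0$. For $N\ge 1$ let $A_N=\{\tfrac1{2N},\tfrac3{2N},\dots,\tfrac{2N-1}{2N}\}$, let $\rho(n)=(n-1)\vee 0$, and let $X^N=(X_t)_{0\le t\le T}$ be the càdlàg Markov jump process on $\mathbb N^{A_N}$, with law $P^N$ and expectation $E^N$, whose generator is $$\mathcal L_Nf(\eta)=N^2\sum_{x\in A_N}\rho(\eta_x)\big[f(\eta^{x,x-1/N})-f(\eta)+f(\eta^{x,x+1/N})-f(\eta)\big]+aN\big[f(\sigma(\eta))-f(\eta)\big].$$ Here $\eta^{x,y}$ is obtained from $\eta$ by moving one particle from $x$ to $y$ if $y\in A_N$, and $\eta^{x,y}=\eta$ if $y\notin A_N$; and $\sigma(\eta)$ is obtained from $\eta$ by moving every particle not at the leftmost site $\tfrac1{2N}$ one site to the left, the particles at $\tfrac1{2N}$ staying there. Let $\Omega_N'$ be the set of $\eta\in\mathbb N^{A_N}$ with $\sum_{x\in A_N}\eta_x=N$ for which there is $b$ with $\eta_x>0$ for all $x<b$ and $\eta_x=0$ for all $x\ge b$. Let $\mathcal M$ be the space of finite positive measures on $[0,1]$ with the topology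 of weak convergence, let $D([0,T],\mathcal M)$ be the Skorokhod space of càdlàg paths in $\mathcal M$ (with the $J_1$ topology), and let $Q^N$ be the law on $D([0,T],\mathcal M)$ of the path of empirical measures $t\mapsto \frac1N\sum_{x\in A_N}X_t(x)\,\delta_x$ under $P^N$. Suppose that, for each $N\ge 1$, $X_0\in\Omega_N'$ $P^N$-almost surely, and that $$\sup_{N\ge1}E^N\Big[\frac1N\sum_{x\in A_N}X_0(x)^2\Big]<\infty .$$ Let the probability measure $Q^\infty$ on $D([0,T],\mathcal M)$ be a subsequential limit of $(Q^N)$ in the sense of weak convergence. Then for $Q^\infty$-almost every path $\mu=(\mu_t)_{0\le t\le T}$ there is a nonnegative $u\in L^2([0,T]\times[0,1])$ such that $\mu_t(dx)=u(t,x)\,dx$ for Lebesgue-almost every $t\in[0,T]$. -/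

import Mathlib

open MeasureTheory ProbabilityTheory Filter Topology
open scoped ENNReal NNReal unitInterval

/-- The space `D([0,T], E)` of càdlàg paths: right-continuous functions on `[0,T]` with values in
`E` that have left limits. -/
structure SkorokhodSpace (T : ℝ) (E : Type*) [TopologicalSpace E] where
  toFun : Set.Icc (0 : ℝ) T → E
  right_continuous : ∀ t, ContinuousWithinAt toFun (Set.Ici t) t
  left_limit : ∀ t, ∃ l, Tendsto toFun (𝓝[<] t) (𝓝 l)

namespace SkorokhodSpace

variable {T : ℝ} {E : Type*} [TopologicalSpace E]

instance : CoeFun (SkorokhodSpace T E) (fun _ => Set.Icc (0 : ℝ) T → E) := ⟨toFun⟩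

/-- The paths `y` that, after a time change `τ` of `[0,T]` (an increasing bijection) moving no time
by `δ` or more, are `V`-close to `x` at all times. -/
def basicNhd (x : SkorokhodSpace T E) (δ : ℝ) (V : Set (E × E)) : Set (SkorokhodSpace T E) :=
  {y | ∃ τ : Set.Icc (0 : ℝ) T ≃o Set.Icc (0 : ℝ) T,
    ∀ t, |(τ t : ℝ) - (t : ℝ)| < δ ∧ (x t, y (τ t)) ∈ V}

/-- The Skorokhod `J₁` topology. Closeness of values is measured by neighbourhoods `V` of the
diagonal of `E × E`. If `E` is metrizable and `d` is any compatible metric, then, since the range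
of a càdlàg path is relatively compact, one may restrict to `V = {(p, q) | d p q < ε}`, so that this
is the topology of the usual Skorokhod metric
`inf_τ max (sup_t |τ t - t|) (sup_t d (x t) (y (τ t)))`. -/
instance : TopologicalSpace (SkorokhodSpace T E) where
  IsOpen U := ∀ x ∈ U, ∃ δ > 0, ∃ V ∈ 𝓝ˢ (Set.diagonal E), basicNhd x δ V ⊆ U
  isOpen_univ := fun _ _ => ⟨1, one_pos, Set.univ, univ_mem, Set.subset_univ _⟩
  isOpen_inter := by
    rintro U₁ U₂ h₁ h₂ x ⟨hx₁, hx₂⟩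
    obtain ⟨δ₁, hδ₁, V₁, hV₁, hs₁⟩ := h₁ x hx₁
    obtain ⟨δ₂, hδ₂, V₂, hV₂, hs₂⟩ := h₂ x hx₂
    refine ⟨min δ₁ δ₂, lt_min hδ₁ hδ₂, V₁ ∩ V₂, inter_mem hV₁ hV₂, ?_⟩
    rintro y ⟨τ, hτ⟩
    exact ⟨hs₁ ⟨τ, fun t => ⟨(hτ t).1.trans_le (min_le_left _ _), (hτ t).2.1⟩⟩,
      hs₂ ⟨τ, fun t => ⟨(hτ t).1.trans_le (min_le_right _ _), (hτ t).2.2⟩⟩⟩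
  isOpen_sUnion := by
    rintro S hS x ⟨U, hU, hx⟩
    obtain ⟨δ, hδ, V, hV, hs⟩ := hS U hU x hx
    exact ⟨δ, hδ, V, hV, hs.trans (Set.subset_sUnion_of_mem hU)⟩

theorem isOpen_iff {U : Set (SkorokhodSpace T E)} :
    IsOpen U ↔ ∀ x ∈ U, ∃ δ > 0, ∃ V ∈ 𝓝ˢ (Set.diagonal E), basicNhd x δ V ⊆ U := Iff.rfl

instance : MeasurableSpace (SkorokhodSpace T E) := borel _

instance : BorelSpace (SkorokhodSpace T E) := ⟨rfl⟩

/-- The path `t ↦ g (x t)`, for continuous `g`. -/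
def comp {F : Type*} [TopologicalSpace F] (g : E → F) (hg : Continuous g)
    (x : SkorokhodSpace T E) : SkorokhodSpace T F where
  toFun t := g (x t)
  right_continuous t := hg.continuousAt.comp_continuousWithinAt (x.right_continuous t)
  left_limit t := by
    obtain ⟨l, hl⟩ := x.left_limit t
    exact ⟨g l, (hg.tendsto l).comp hl⟩

theorem continuous_comp {F : Type*} [TopologicalSpace F] (g : E → F) (hg : Continuous g) :
    Continuous (comp (T := T) g hg) := by
  refine ⟨fun U hU x hx => ?_⟩
  obtain ⟨δ, hδ, V, hV, hs⟩ := hU _ hx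
  refine ⟨δ, hδ, Prod.map g g ⁻¹' V, ?_, ?_⟩
  · rw [mem_nhdsSet_iff_forall] at hV ⊢
    rintro ⟨p, q⟩ hpq
    have hpq' : p = q := hpq
    subst hpq'
    exact (hg.prodMap hg).continuousAt (hV (g p, g p) rfl)
  · rintro y ⟨τ, hτ⟩
    exact hs ⟨τ, fun t => ⟨(hτ t).1, (hτ t).2⟩⟩

/-- Coordinates are Borel measurable (for discrete `E`). -/
theorem measurable_eval [DiscreteTopology E] [Countable E] [MeasurableSpace E]
    (t : Set.Icc (0 : ℝ) T) : Measurable (fun x : SkorokhodSpace T E => x t) := by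
  have hdiag : Set.diagonal E ∈ 𝓝ˢ (Set.diagonal E) :=
    (isOpen_discrete _).mem_nhdsSet.2 subset_rfl
  refine measurable_to_countable' fun e => ?_
  by_cases ht : (t : ℝ) = T
  · have : IsOpen ((fun x : SkorokhodSpace T E => x t) ⁻¹' {e}) := by
      intro x hx
      refine ⟨1, one_pos, _, hdiag, ?_⟩
      rintro y ⟨τ, hτ⟩
      have htop : IsMax t := fun s _ => Subtype.coe_le_coe.1 (s.2.2.trans ht.ge)
      have hfix : τ t = t :=
        le_antisymm (htop.isTop _) (by
          have := τ.monotone (htop.isTop (τ.symm t))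
          simpa using this)
      have h2 : x t = y (τ t) := (hτ t).2
      have hx' : x t = e := hx
      rw [hfix] at h2
      exact h2.symm.trans hx'
    exact this.measurableSet
  · have htT : (t : ℝ) < T := lt_of_le_of_ne t.2.2 ht
    let A : ℕ → Set (SkorokhodSpace T E) := fun n =>
      {x | ∀ s : Set.Icc (0 : ℝ) T, (t : ℝ) < s → (s : ℝ) < t + 1 / ((n : ℝ) + 1) → x s = e}
    have hA : ∀ n, IsClosed (A n) := by
      intro n
      rw [← isOpen_compl_iff]
      intro x hx
      have hx' : ∃ s : Set.Icc (0 : ℝ) T, (t : ℝ) < s ∧ (s : ℝ) < t + 1 / ((n : ℝ) + 1) ∧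
          x s ≠ e := by
        have hx2 : ¬ ∀ s : Set.Icc (0 : ℝ) T, (t : ℝ) < s →
          (s : ℝ) < t + 1 / ((n : ℝ) + 1) → x s = e := hx
        push Not at hx2
        exact hx2
      obtain ⟨s, hs1, hs2, hs3⟩ := hx'
      refine ⟨min ((s : ℝ) - t) (t + 1 / ((n : ℝ) + 1) - s),
        lt_min (sub_pos.2 hs1) (sub_pos.2 hs2), _, hdiag, ?_⟩
      rintro y ⟨τ, hτ⟩ hy
      have h1 := (hτ s).1
      rw [lt_min_iff, abs_lt, abs_lt] at h1
      have h2 : x s = y (τ s) := (hτ s).2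
      exact hs3 (h2.trans (hy (τ s) (by linarith [h1.1.1]) (by linarith [h1.2.2])))
    have : (fun x : SkorokhodSpace T E => x t) ⁻¹' {e} = ⋃ n, A n := by
      ext x
      have hev : ∀ᶠ s in 𝓝[≥] t, x s = x t :=
        (x.right_continuous t).eventually (IsOpen.mem_nhds (isOpen_discrete {x t}) rfl)
      have hev' : ∃ n : ℕ, ∀ s : Set.Icc (0 : ℝ) T, (t : ℝ) ≤ s →
          (s : ℝ) < t + 1 / ((n : ℝ) + 1) → x s = x t := by
        rw [eventually_nhdsWithin_iff, Metric.eventually_nhds_iff] at hev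
        obtain ⟨ε, hε, h⟩ := hev
        obtain ⟨n, hn⟩ := exists_nat_one_div_lt hε
        refine ⟨n, fun s hs1 hs2 => h ?_ hs1⟩
        rw [Subtype.dist_eq, Real.dist_eq, abs_lt]
        constructor <;> linarith
      obtain ⟨n, hn⟩ := hev'
      simp only [Set.mem_preimage, Set.mem_singleton_iff, Set.mem_iUnion]
      constructor
      · intro hx
        exact ⟨n, fun s h1 h2 => (hn s h1.le h2).trans hx⟩
      · rintro ⟨m, hm⟩
        obtain ⟨r, hr1, hr2⟩ := exists_between (lt_min htT (lt_min
          (lt_add_of_pos_right (t : ℝ) (Nat.one_div_pos_of_nat (α := ℝ) (n := n)))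
          (lt_add_of_pos_right (t : ℝ) (Nat.one_div_pos_of_nat (α := ℝ) (n := m)))))
        rw [lt_min_iff, lt_min_iff] at hr2
        have hrI : r ∈ Set.Icc (0 : ℝ) T := ⟨t.2.1.trans hr1.le, hr2.1.le⟩
        exact (hn ⟨r, hrI⟩ hr1.le hr2.2.1).symm.trans (hm ⟨r, hrI⟩ hr1 hr2.2.2)
    rw [this]
    exact MeasurableSet.iUnion fun n => (hA n).measurableSet

end SkorokhodSpace

namespace ZeroRange

/-- Particle configurations on `A_N = {1/2N, 3/2N, …, (2N-1)/2N}`; the index `i : Fin N` stands for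
the site `(2i+1)/2N`. -/
abbrev Config (N : ℕ) : Type := Fin N → ℕ

/-- The site `(2i+1)/2N`, as a point of `[0,1]`. -/
noncomputable def site {N : ℕ} (i : Fin N) : I :=
  ⟨(2 * (i : ℝ) + 1) / (2 * (N : ℝ)), by
    have hi : (i : ℝ) + 1 ≤ N := by exact_mod_cast i.2
    have h0 : (0 : ℝ) ≤ i := Nat.cast_nonneg _
    exact ⟨by positivity, div_le_one_of_le₀ (by linarith) (by positivity)⟩⟩

/-- The empirical measure `∑_x (η_x / N) δ_x`. The space of finite measures on `[0,1]` carries the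
topology of weak convergence. -/
noncomputable def empirical {N : ℕ} (η : Config N) : FiniteMeasure I :=
  ∑ i, ((η i : ℝ≥0) / (N : ℝ≥0)) • (diracProba (site i)).toFiniteMeasure

/-- `ρ(n) = (n - 1) ∨ 0`. -/
def rho (n : ℕ) : ℝ := max ((n : ℝ) - 1) 0

/-- Move one particle from site `i` to site `j ≠ i`. -/
def move {N : ℕ} (η : Config N) (i j : Fin N) : Config N :=
  fun y => if y = i then η y - 1 else if y = j then η y + 1 else η y

/-- `η^{x,x+1/N}`: equal to `η` if `x + 1/N` is not a site. -/
def moveRight {N : ℕ} (η : Config N) (i : Fin N) : Config N :=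
  if h : (i : ℕ) + 1 < N then move η i ⟨i + 1, h⟩ else η

/-- `η^{x,x-1/N}`: equal to `η` if `x - 1/N` is not a site. -/
def moveLeft {N : ℕ} (η : Config N) (i : Fin N) : Config N :=
  if 0 < (i : ℕ) then move η i ⟨i - 1, lt_of_le_of_lt (Nat.sub_le _ _) i.2⟩ else η

/-- `σ(η)`: all particles move one site to the left, except those at the leftmost site, which
stay. -/
def shift {N : ℕ} (η : Config N) : Config N :=
  fun y => (if (y : ℕ) = 0 then η y else 0) +
    (if h : (y : ℕ) + 1 < N then η ⟨y + 1, h⟩ else 0)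

/-- The generator
`L_N f(η) = N² ∑_x ρ(η_x) [f(η^{x,x-1/N}) - f(η) + f(η^{x,x+1/N}) - f(η)] + a N (f(σ(η)) - f(η))`. -/
noncomputable def generator (a : ℝ) {N : ℕ} (f : Config N → ℝ) (η : Config N) : ℝ :=
  (N : ℝ) ^ 2 * ∑ i, rho (η i) * ((f (moveLeft η i) - f η) + (f (moveRight η i) - f η))
    + a * N * (f (shift η) - f η)

/-- The filtration `σ(x_s : s ≤ t)` generated by the coordinate process on path space. -/
noncomputable def pathFiltration (T : ℝ) (N : ℕ) :
    Filtration (Set.Icc (0 : ℝ) T)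
      (inferInstance : MeasurableSpace (SkorokhodSpace T (Config N))) :=
  Filtration.natural (fun t (x : SkorokhodSpace T (Config N)) => x t)
    (fun t => (SkorokhodSpace.measurable_eval t).stronglyMeasurable)

/-- Lebesgue measure on the time interval `[0,T]`. -/
noncomputable def timeMeasure (T : ℝ) : Measure (Set.Icc (0 : ℝ) T) :=
  volume.comap Subtype.val

/-- `P` is the law on `D([0,T], ℕ^{A_N})` of the Markov jump process with generator `L_N` (and some
initial law), expressed as the martingale problem: for each finitely supported `f`,
`f(x_t) - ∫_0^t L_N f(x_s) ds` is a martingale. (The jumps preserve the number of particles, so the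
process splits into finite-state chains, and the martingale problem is well posed for every initial
law.) -/
def IsProcessLaw (T a : ℝ) (N : ℕ) (P : Measure (SkorokhodSpace T (Config N))) : Prop :=
  ∀ f : Config N → ℝ, (Function.support f).Finite →
    Martingale (fun (t : Set.Icc (0 : ℝ) T) (x : SkorokhodSpace T (Config N)) =>
      f (x t) - ∫ s in Set.Iic t, generator a f (x s) ∂timeMeasure T) (pathFiltration T N) P

/-- The set `Ω'_N` of configurations of `N` particles whose occupied sites are exactly those to the
left of some point. -/
def Omega' (N : ℕ) : Set (Config N) :=
  {η | ∑ i, η i = N ∧ ∃ b : ℕ, ∀ i : Fin N, ((i : ℕ) < b → 0 < η i) ∧ (b ≤ (i : ℕ) → η i = 0)}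

/-- The law `Q^N` on `D([0,T], 𝓜)` of the path of empirical measures under `P^N`. -/
noncomputable def empiricalLaw {T : ℝ} {N : ℕ}
    (P : ProbabilityMeasure (SkorokhodSpace T (Config N))) :
    ProbabilityMeasure (SkorokhodSpace T (FiniteMeasure I)) :=
  P.map (f := SkorokhodSpace.comp empirical continuous_of_discreteTopology)
    (SkorokhodSpace.continuous_comp _ _).measurable.aemeasurable

end ZeroRange

/-! The proof is an `H⁻¹` energy estimate. Let `c_j` be the number of particles on the first `j`
sites and `V = N⁻³ ∑ (c_j - j)²`, which lies in `[0, 1]` when there are `N` particles. A jump across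
a bond changes a single `c_j` by one, so for a site with `ρ > 0` the left and right contributions
telescope to `2 - 2ρ`. Together with a shift cost of at most `2a` this gives `L_N V ≤ 2 + 2a - 2D`,
where `D = N⁻¹ ∑ ρ(η_x)²` (`generator_potentialEnergy_le`). The martingale problem turns this into a
bound on `E ∫ D dt`, uniform in `N`.

By Young's inequality `D` dominates `⟨m, g⟩ - ½ ∫ g²` for the empirical measure `m`, up to a
constant and a Riemann-sum error (`energyTest_empirical_le`). Finite maxima of these functionals
over a dense sequence of `g`, truncated to be bounded, have time integrals that are bounded and
`J₁`-continuous, so their expectations pass to the weak limit (`continuous_integral_comp`). Monotone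
convergence removes the truncation: almost every limit path has finite time-integrated energy. By
duality finite energy means an `L²` density (`lintegral_rnDeriv_sq_le`), and a kernel Radon–Nikodym
derivative makes it jointly measurable in time and space. -/

/-! ### Time integrals along càdlàg paths. -/

namespace SkorokhodSpace

variable {T : ℝ} {E : Type*} [TopologicalSpace E]

/-- At a discontinuity some rational separates the left limit from the value. For a fixed rational
and a fixed direction, such times are isolated from the left within their set, hence countable. -/
theorem countable_not_continuousAt (x : SkorokhodSpace T ℝ) :
    {t | ¬ ContinuousAt x t}.Countable := by
  let A : ℚ → Set (Set.Icc (0 : ℝ) T) := fun q => {t | x t < q ∧ ∀ᶠ s in 𝓝[<] t, (q : ℝ) < x s}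
  let B : ℚ → Set (Set.Icc (0 : ℝ) T) := fun q => {t | (q : ℝ) < x t ∧ ∀ᶠ s in 𝓝[<] t, x s < q}
  have isolated : ∀ S : Set (Set.Icc (0 : ℝ) T), (∀ t ∈ S, ∀ᶠ s in 𝓝[<] t, s ∉ S) →
      S.Countable := by
    intro S hS
    refine (countable_setOfPred_isolated_left_within (s := S)).mono fun t ht => ?_
    have h := hS t ht
    refine ⟨ht, ?_⟩
    rw [Set.inter_comm, nhdsWithin_inter', ← Filter.empty_mem_iff_bot]
    filter_upwards [mem_inf_of_left h, mem_inf_of_right (mem_principal_self S)] with s h1 h2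
    exact (h1 h2).elim
  have hA : ∀ q, (A q).Countable := fun q => isolated _ fun t ht =>
    ht.2.mono fun s hs hs' => (hs.trans hs'.1).false
  have hB : ∀ q, (B q).Countable := fun q => isolated _ fun t ht =>
    ht.2.mono fun s hs hs' => (hs.trans hs'.1).false
  refine ((Set.countable_iUnion hA).union (Set.countable_iUnion hB)).mono fun t ht => ?_
  obtain ⟨l, hl⟩ := x.left_limit t
  rcases lt_trichotomy l (x t) with h | h | h
  · obtain ⟨q, h1, h2⟩ := exists_rat_btwn h
    exact Or.inr (Set.mem_iUnion.2 ⟨q, h2, hl.eventually (gt_mem_nhds h1)⟩)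
  · refine (ht ?_).elim
    rw [ContinuousAt, ← nhdsLT_sup_nhdsGE]
    exact (h ▸ hl).sup (x.right_continuous t)
  · obtain ⟨q, h1, h2⟩ := exists_rat_btwn h
    exact Or.inl (Set.mem_iUnion.2 ⟨q, h1, hl.eventually (lt_mem_nhds h2)⟩)

theorem measurable_path (x : SkorokhodSpace T ℝ) : Measurable (x : Set.Icc (0 : ℝ) T → ℝ) := by
  refine measurable_of_isOpen fun U hU => ?_
  have hsub : x ⁻¹' U \ interior (x ⁻¹' U) ⊆ {t | ¬ ContinuousAt x t} := fun t ht hc =>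
    ht.2 (mem_interior_iff_mem_nhds.2 (hc (hU.mem_nhds ht.1)))
  rw [← Set.union_sdiff_cancel (interior_subset (s := x ⁻¹' U))]
  exact isOpen_interior.measurableSet.union
    (x.countable_not_continuousAt.mono hsub).measurableSet

theorem measurable_comp_path (x : SkorokhodSpace T E) {h : E → ℝ} (hc : Continuous h) :
    Measurable (fun t => h (x t)) :=
  (x.comp h hc).measurable_path

end SkorokhodSpace

instance (T : ℝ) : IsFiniteMeasure (ZeroRange.timeMeasure T) := by
  refine ⟨?_⟩
  rw [ZeroRange.timeMeasure, comap_subtype_coe_apply measurableSet_Icc, Set.image_univ,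
    Subtype.range_coe, Real.volume_Icc]
  exact ENNReal.ofReal_lt_top

instance (T : ℝ) : NullSingletonClass (ZeroRange.timeMeasure T) := by
  refine ⟨fun t => ?_⟩
  rw [ZeroRange.timeMeasure, comap_subtype_coe_apply measurableSet_Icc, Set.image_singleton,
    Real.volume_singleton]

namespace SkorokhodSpace

variable {T : ℝ} {E : Type*} [TopologicalSpace E]

theorem integrable_comp_path (x : SkorokhodSpace T E) {h : E → ℝ} (hc : Continuous h) {C : ℝ}
    (hC : ∀ e, |h e| ≤ C) : Integrable (fun t => h (x t)) (ZeroRange.timeMeasure T) :=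
  .of_bound (x.measurable_comp_path hc).aestronglyMeasurable C (ae_of_all _ fun _ => hC _)

/-- Otherwise there are time changes tending to the identity that violate the bound. The integrands
converge off the countable, hence null, discontinuity set, contradicting dominated convergence. -/
theorem exists_timeChange_integral_lt (x : SkorokhodSpace T E) {h : E → ℝ} (hc : Continuous h)
    {C : ℝ} (hC : ∀ e, |h e| ≤ C) {ε : ℝ} (hε : 0 < ε) :
    ∃ δ > 0, ∀ τ : Set.Icc (0 : ℝ) T ≃o Set.Icc (0 : ℝ) T, (∀ t, |(τ t : ℝ) - t| < δ) →
      |∫ t, h (x (τ.symm t)) ∂ZeroRange.timeMeasure T - ∫ t, h (x t) ∂ZeroRange.timeMeasure T|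
        < ε := by
  by_contra! hcon
  choose τ hτ hbad using fun n : ℕ => hcon (1 / ((n : ℝ) + 1)) (Nat.one_div_pos_of_nat)
  have hconv : ∀ t, Tendsto (fun n => (τ n).symm t) atTop (𝓝 t) := by
    intro t
    rw [tendsto_iff_dist_tendsto_zero]
    refine squeeze_zero (fun _ => dist_nonneg) (fun n => ?_) tendsto_one_div_add_atTop_nhds_zero_nat
    have := hτ n ((τ n).symm t)
    rw [OrderIso.apply_symm_apply, abs_sub_comm] at this
    exact this.le
  have hlim : Tendsto (fun n => ∫ t, h (x ((τ n).symm t)) ∂ZeroRange.timeMeasure T) atTop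
      (𝓝 (∫ t, h (x t) ∂ZeroRange.timeMeasure T)) := by
    refine tendsto_integral_of_dominated_convergence (fun _ => C) (fun n => ?_)
      (integrable_const C) (fun n => ae_of_all _ fun t => hC _) ?_
    · exact ((x.measurable_comp_path hc).comp
        (τ n).symm.continuous.measurable).aestronglyMeasurable
    · have hnull := (x.comp h hc).countable_not_continuousAt.measure_zero (ZeroRange.timeMeasure T)
      filter_upwards [measure_eq_zero_iff_ae_notMem.1 hnull] with t ht
      have ht' : ContinuousAt (fun t => h (x t)) t := by
        by_contra h'
        exact ht h'
      exact ht'.tendsto.comp (hconv t)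
  rw [Metric.tendsto_atTop] at hlim
  obtain ⟨n, hn⟩ := hlim ε hε
  exact absurd (hn n le_rfl) (not_lt.2 (hbad n))

/-- Time integrals of bounded continuous functions along the path are `J₁`-continuous. -/
theorem continuous_integral_comp {h : E → ℝ} (hc : Continuous h) {C : ℝ} (hC : ∀ e, |h e| ≤ C) :
    Continuous (fun x : SkorokhodSpace T E => ∫ t, h (x t) ∂ZeroRange.timeMeasure T) := by
  set m := (ZeroRange.timeMeasure T).real Set.univ with hm
  have hm0 : 0 ≤ m := measureReal_nonneg
  refine ⟨fun U hU x hx => ?_⟩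
  obtain ⟨ε, hε, hball⟩ := Metric.isOpen_iff.1 hU _ hx
  obtain ⟨δ, hδ, hτδ⟩ := x.exists_timeChange_integral_lt hc hC (half_pos hε)
  -- The `+ 1` keeps the denominator positive even if the time interval has mass zero.
  have hε' : 0 < ε / (2 * (m + 1)) := by positivity
  refine ⟨δ, hδ, {p | |h p.1 - h p.2| < ε / (2 * (m + 1))}, ?_, ?_⟩
  · refine IsOpen.mem_nhdsSet (isOpen_lt (by fun_prop) continuous_const) |>.2 ?_
    rintro ⟨p, q⟩ hpq
    have hpq' : p = q := hpq
    subst hpq'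
    simpa using hε'
  · rintro y ⟨τ, hτ⟩
    refine hball ?_
    have h1 := hτδ τ fun t => (hτ t).1
    have hint : Integrable (fun t => h (x (τ.symm t))) (ZeroRange.timeMeasure T) :=
      .of_bound ((x.measurable_comp_path hc).comp
        τ.symm.continuous.measurable).aestronglyMeasurable C (ae_of_all _ fun _ => hC _)
    have h2 : |∫ t, h (y t) ∂ZeroRange.timeMeasure T
        - ∫ t, h (x (τ.symm t)) ∂ZeroRange.timeMeasure T| ≤ ε / 2 := by
      rw [← integral_sub (y.integrable_comp_path hc hC) hint, ← Real.norm_eq_abs]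
      refine (norm_integral_le_of_norm_le_const (C := ε / (2 * (m + 1)))
        (ae_of_all _ fun t => ?_)).trans ?_
      · have := (hτ (τ.symm t)).2
        rw [OrderIso.apply_symm_apply] at this
        rw [Real.norm_eq_abs, abs_sub_comm]
        exact le_of_lt this
      · rw [← hm, div_mul_eq_mul_div, div_le_div_iff₀ (by positivity) two_pos]
        nlinarith
    rw [Metric.mem_ball, Real.dist_eq]
    calc _ ≤ _ := abs_sub_le _ (∫ t, h (x (τ.symm t)) ∂ZeroRange.timeMeasure T) _
      _ < ε := by linarith

end SkorokhodSpace

/-! ### Measures of finite energy have square-integrable densities. -/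

/-- The variational functional `g ↦ ⟨m, g⟩ - ½ ∫ g²`, whose supremum over continuous `g` is half
the squared `L²` norm of the density of `m`. -/
noncomputable def energyTest (m : Measure I) (g : I → ℝ) : ℝ :=
  ∫ x, g x ∂m - (∫ x, g x ^ 2) / 2

/-- Convergence in `L²(m + volume)` controls both terms at once: it gives `L¹(m)` convergence for
the linear one, as `m` is finite, and `L²(volume)` convergence for the quadratic one. -/
theorem tendsto_energyTest (m : Measure I) [IsFiniteMeasure m] {g : ℕ → I → ℝ} {f : I → ℝ}
    (hg : ∀ n, MemLp (g n) 2 (m + volume)) (hf : MemLp f 2 (m + volume))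
    (h : Tendsto (fun n => eLpNorm (g n - f) 2 (m + volume)) atTop (𝓝 0)) :
    Tendsto (fun n => energyTest m (g n)) atTop (𝓝 (energyTest m f)) := by
  have hmle : m ≤ m + volume := Measure.le_add_right le_rfl
  have hvle : (volume : Measure I) ≤ m + volume := Measure.le_add_left le_rfl
  have hm : Tendsto (fun n => eLpNorm (g n - f) 2 m) atTop (𝓝 0) :=
    tendsto_of_tendsto_of_tendsto_of_le_of_le tendsto_const_nhds h (fun _ => zero_le)
      (fun n => eLpNorm_mono_measure _ hmle)
  have hv : Tendsto (fun n => eLpNorm (g n - f) 2 (volume : Measure I)) atTop (𝓝 0) :=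
    tendsto_of_tendsto_of_tendsto_of_le_of_le tendsto_const_nhds h (fun _ => zero_le)
      (fun n => eLpNorm_mono_measure _ hvle)
  refine Tendsto.sub ?_ (Tendsto.div_const ?_ 2)
  · have hc : Tendsto (fun n => eLpNorm (g n - f) 2 m * m Set.univ ^ (1 / (1 : ℝ≥0∞).toReal - 1 / (2 : ℝ≥0∞).toReal)) atTop (𝓝 0) := by
      have := ENNReal.Tendsto.mul_const hm (b := m Set.univ ^ (1 / (1 : ℝ≥0∞).toReal - 1 / (2 : ℝ≥0∞).toReal))
        (Or.inr (by
          refine ENNReal.rpow_ne_top_of_nonneg (by norm_num) (measure_ne_top _ _)))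
      simpa using this
    refine tendsto_integral_of_L1' _ (hf.mono_measure hmle).1
      (Eventually.of_forall fun n => ((hg n).mono_measure hmle).integrable one_le_two) ?_
    refine tendsto_of_tendsto_of_tendsto_of_le_of_le tendsto_const_nhds hc (fun _ => zero_le)
      (fun n => eLpNorm_le_eLpNorm_mul_rpow_measure_univ one_le_two
        (((hg n).mono_measure hmle).sub (hf.mono_measure hmle)).1)
  · have hgv := fun n => (hg n).mono_measure hvle
    have hfv := hf.mono_measure hvle
    have key : ∀ {k : I → ℝ} (hk : MemLp k 2 (volume : Measure I)),
        ∫ x, k x ^ 2 = ‖hk.toLp k‖ ^ 2 := by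
      intro k hk
      rw [← real_inner_self_eq_norm_sq, L2.inner_def]
      refine integral_congr_ae ?_
      filter_upwards [hk.coeFn_toLp] with x hx
      simp [hx, sq]
    simp_rw [key hfv, fun n => key (hgv n)]
    refine Tendsto.pow (Tendsto.norm ?_) 2
    rw [Lp.tendsto_Lp_iff_tendsto_eLpNorm'']
    exact hv

theorem energyTest_le_of_continuous {m : Measure I} [IsFiniteMeasure m] {c : ℝ}
    (h : ∀ g : C(I, ℝ), energyTest m g ≤ c) {f : I → ℝ} (hf : MemLp f 2 (m + volume)) :
    energyTest m f ≤ c := by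
  choose g hg hg' using fun n : ℕ => hf.exists_boundedContinuous_eLpNorm_sub_le (by simp)
    (ε := ((n : ℝ≥0∞) + 1)⁻¹) (by simp)
  have := tendsto_energyTest m hg' hf (by
    refine tendsto_of_tendsto_of_tendsto_of_le_of_le tendsto_const_nhds
      ?_ (fun _ => zero_le) (fun n => (eLpNorm_sub_comm _ _ _ _).trans_le (hg n))
    exact_mod_cast (ENNReal.tendsto_inv_nat_nhds_zero.comp (tendsto_add_atTop_nat 1)))
  exact le_of_tendsto this (Eventually.of_forall fun n => h (g n).toContinuousMap)

/-- Testing with `n · 1_A` for a Lebesgue-null `A` kills the quadratic term and leaves `n m(A) ≤ c`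
for every `n`. -/
theorem absolutelyContinuous_of_energyTest_le {m : Measure I} [IsFiniteMeasure m] {c : ℝ}
    (h : ∀ g : C(I, ℝ), energyTest m g ≤ c) : m ≪ volume := by
  refine Measure.AbsolutelyContinuous.mk fun A hA h0 => ?_
  have key : ∀ n : ℕ, n * m.real A ≤ c := by
    intro n
    have := energyTest_le_of_continuous h (f := A.indicator fun _ => (n : ℝ))
      ((memLp_const _).indicator hA)
    have h2 : ∫ x, (A.indicator (fun _ => (n : ℝ)) x) ^ 2 = 0 := by
      refine integral_eq_zero_of_ae ?_
      filter_upwards [measure_eq_zero_iff_ae_notMem.1 h0] with x hx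
      simp [hx]
    rw [energyTest, h2, integral_indicator_const _ hA, smul_eq_mul] at this
    linarith
  by_contra hne
  have hpos : 0 < m.real A := by
    rw [measureReal_def]
    exact ENNReal.toReal_pos hne (measure_ne_top _ _)
  obtain ⟨n, hn⟩ := exists_nat_gt (c / m.real A)
  rw [div_lt_iff₀ hpos] at hn
  linarith [key n]

/-- The optimal test function is the density `u` itself. Its truncation `f = min u n` is admissible,
and `∫ f² ≤ ∫ f u = ∫ f dm` gives `½ ∫ f² ≤ c`; then let `n → ∞`. -/
theorem lintegral_rnDeriv_sq_le {m : Measure I} [IsFiniteMeasure m] {c : ℝ}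
    (h : ∀ g : C(I, ℝ), energyTest m g ≤ c) :
    ∫⁻ x, (m.rnDeriv volume x) ^ 2 ≤ ENNReal.ofReal (2 * c) := by
  have hac := absolutelyContinuous_of_energyTest_le h
  set u := m.rnDeriv volume with hu
  have hum : Measurable u := Measure.measurable_rnDeriv _ _
  have hsup : ∀ᵐ x, u x ^ 2 = ⨆ n : ℕ, (min (u x) n) ^ 2 := by
    filter_upwards [Measure.rnDeriv_lt_top m volume] with x hx
    refine le_antisymm ?_ (iSup_le fun n => by gcongr; exact min_le_left _ _)
    obtain ⟨n, hn⟩ := ENNReal.exists_nat_gt hx.ne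
    exact (by rw [min_eq_left hn.le] : u x ^ 2 ≤ min (u x) n ^ 2).trans
      (le_iSup (fun n : ℕ => min (u x) (n : ℝ≥0∞) ^ 2) n)
  rw [lintegral_congr_ae hsup, lintegral_iSup (by fun_prop)]
  swap
  · intro i j hij x
    dsimp only
    gcongr
  refine iSup_le fun n => ?_
  let f : I → ℝ := fun x => (min (u x) n).toReal
  have hfm : Measurable f := by fun_prop
  have hfn : ∀ x, f x ≤ n := fun x => ENNReal.toReal_le_of_le_ofReal (by positivity) (by simp)
  have hf0 : ∀ x, 0 ≤ f x := fun x => ENNReal.toReal_nonneg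
  have hfL : ∀ (μ : Measure I) [IsFiniteMeasure μ] (p : ℝ≥0∞), MemLp f p μ := fun μ _ p =>
    .of_bound hfm.aestronglyMeasurable n (ae_of_all _ fun x => by
      rw [Real.norm_of_nonneg (hf0 x)]; exact hfn x)
  have h1 := energyTest_le_of_continuous h (hfL _ 2)
  have h2 : ∫ x, f x ^ 2 ≤ ∫ x, f x ∂m := by
    rw [← integral_rnDeriv_smul hac]
    refine integral_mono_ae (hfL _ 2).integrable_sq ?_ ?_
    · rw [integrable_rnDeriv_smul_iff hac]
      exact (hfL _ 1).integrable le_rfl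
    · filter_upwards [Measure.rnDeriv_lt_top m volume] with x hx
      rw [sq, smul_eq_mul]
      refine mul_le_mul_of_nonneg_right ?_ (hf0 x)
      exact ENNReal.toReal_mono hx.ne (min_le_left _ _)
  have h3 : ∫⁻ x, (min (u x) n) ^ 2 = ENNReal.ofReal (∫ x, f x ^ 2) := by
    rw [ofReal_integral_eq_lintegral_ofReal (hfL _ 2).integrable_sq
      (ae_of_all _ fun x => sq_nonneg _)]
    refine lintegral_congr fun x => ?_
    rw [ENNReal.ofReal_pow (hf0 x), ENNReal.ofReal_toReal (by simp)]
  rw [h3]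
  refine ENNReal.ofReal_le_ofReal ?_
  rw [energyTest] at h1
  linarith

theorem continuous_energyTest_right (m : Measure I) [IsFiniteMeasure m] :
    Continuous fun g : C(I, ℝ) => energyTest m g := by
  have hint : ∀ (μ : Measure I) [IsFiniteMeasure μ], Continuous fun g : C(I, ℝ) => ∫ x, g x ∂μ := by
    intro μ _
    refine (LipschitzWith.of_dist_le_mul (K := (μ.real Set.univ).toNNReal) fun f g => ?_).continuous
    have hi : ∀ f : C(I, ℝ), Integrable f μ := fun f =>
      f.continuous.integrable_of_hasCompactSupport (HasCompactSupport.of_compactSpace f)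
    rw [Real.dist_eq, ← integral_sub (hi f) (hi g), Real.coe_toNNReal _ measureReal_nonneg,
      mul_comm, ← Real.norm_eq_abs]
    exact norm_integral_le_of_norm_le_const (ae_of_all _ fun x => by
      rw [← dist_eq_norm]; exact ContinuousMap.dist_apply_le_dist x)
  exact (hint m).sub (((hint volume).comp (continuous_pow 2)).div_const 2)

theorem energyTest_le_of_denseRange {m : Measure I} [IsFiniteMeasure m] {c : ℝ}
    {g : ℕ → C(I, ℝ)} (hg : DenseRange g) (h : ∀ n, energyTest m (g n) ≤ c) (f : C(I, ℝ)) :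
    energyTest m f ≤ c :=
  hg.induction_on f (isClosed_le (continuous_energyTest_right m) continuous_const) h

theorem continuous_energyTest_left (g : C(I, ℝ)) :
    Continuous fun m : FiniteMeasure I => energyTest m g :=
  (FiniteMeasure.continuous_integral_continuousMap g).sub continuous_const

/-- Thickened indicators give measurability of the mass of closed sets, a π-system generating the
Borel sets. -/
theorem measurable_toMeasure_of_forall_integral {α : Type*} [MeasurableSpace α]
    {κ : α → FiniteMeasure I} (h : ∀ g : C(I, ℝ), Measurable fun t => ∫ x, g x ∂(κ t : Measure I)) :
    Measurable fun t => (κ t : Measure I) := by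
  have hclosed : ∀ F : Set I, IsClosed F → Measurable fun t => (κ t : Measure I) F := by
    intro F hF
    have hlim := fun t => tendsto_integral_thickenedIndicator_of_isClosed (κ t : Measure I) hF
      (δs := fun n : ℕ => 1 / ((n : ℝ) + 1)) (fun n => Nat.one_div_pos_of_nat)
      tendsto_one_div_add_atTop_nhds_zero_nat
    have hmeas : Measurable fun t => (κ t : Measure I).real F :=
      measurable_of_tendsto_metrizable (fun n => h ⟨fun x => (thickenedIndicator
        (Nat.one_div_pos_of_nat (α := ℝ) (n := n)) F x : ℝ), by fun_prop⟩)
        (tendsto_pi_nhds.2 hlim)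
    convert hmeas.ennreal_ofReal with t
    exact (ofReal_measureReal (measure_ne_top _ _)).symm
  refine Measurable.measure_of_isPiSystem (borel_eq_generateFrom_isClosed (α := I) ▸ BorelSpace.measurable_eq)
    isPiSystem_isClosed (fun F hF => hclosed F hF) (hclosed _ isClosed_univ)

/-! ### Cumulative counts and their changes under the dynamics. -/

namespace ZeroRange

variable {N : ℕ}

/-- The number of particles at site `k`, extended by zero to all `k : ℕ`. -/
def occ (η : Config N) (k : ℕ) : ℝ := if h : k < N then (η ⟨k, h⟩ : ℝ) else 0

/-- The number of particles on the sites `0, …, j - 1`. -/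
def cum (η : Config N) (j : ℕ) : ℝ := ∑ k ∈ Finset.range j, occ η k

theorem occ_coe (η : Config N) (i : Fin N) : occ η i = η i := by simp [occ]

theorem occ_nonneg (η : Config N) (k : ℕ) : 0 ≤ occ η k := by
  unfold occ; split_ifs <;> positivity

theorem cum_succ (η : Config N) (j : ℕ) : cum η (j + 1) = cum η j + occ η j :=
  Finset.sum_range_succ _ _

theorem cum_zero (η : Config N) : cum η 0 = 0 := Finset.sum_range_zero _

theorem cum_nonneg (η : Config N) (j : ℕ) : 0 ≤ cum η j :=
  Finset.sum_nonneg fun _ _ => occ_nonneg _ _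

theorem cum_mono (η : Config N) : Monotone (cum η) :=
  monotone_nat_of_le_succ fun j => by rw [cum_succ]; linarith [occ_nonneg η j]

theorem cum_eq_sum (η : Config N) : cum η N = ∑ i, (η i : ℝ) := by
  rw [cum, ← Fin.sum_univ_eq_sum_range]
  simp [occ]

/-- Nonemptiness of site `i` makes the natural-number subtraction in `move` a genuine one. -/
theorem occ_move (η : Config N) {i j : Fin N} (hij : i ≠ j) (hi : 0 < η i) (k : ℕ) :
    occ (move η i j) k = occ η k + ((if k = j then 1 else 0) - (if k = i then 1 else 0)) := by
  unfold occ move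
  by_cases h : k < N
  · have hi' : ((η i - 1 : ℕ) : ℝ) = η i - 1 := by rw [Nat.cast_sub hi, Nat.cast_one]
    by_cases h1 : k = i
    · subst h1
      have h2 : (i : ℕ) ≠ j := fun h => hij (Fin.ext h)
      simp [hi', h2, sub_eq_add_neg]
    · by_cases h2 : k = j
      · subst h2
        simp [h1, Fin.ext_iff]
      · simp [h, h1, h2, Fin.ext_iff]
  · have h1 : k ≠ i := fun h' => h (h' ▸ i.2)
    have h2 : k ≠ j := fun h' => h (h' ▸ j.2)
    simp [h, h1, h2]

theorem cum_move (η : Config N) {i j : Fin N} (hij : i ≠ j) (hi : 0 < η i) (k : ℕ) :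
    cum (move η i j) k =
      cum η k + ((if (j : ℕ) < k then 1 else 0) - (if (i : ℕ) < k then 1 else 0)) := by
  simp only [cum, occ_move η hij hi, Finset.sum_add_distrib, Finset.sum_sub_distrib,
    Finset.sum_ite_eq', Finset.mem_range]

theorem cum_moveRight (η : Config N) (i : Fin N) (hi : 0 < η i) (h : (i : ℕ) + 1 < N) (k : ℕ) :
    cum (moveRight η i) k = cum η k - (if k = i + 1 then 1 else 0) := by
  rw [moveRight, dif_pos h, cum_move η (by simp [Fin.ext_iff]) hi]
  simp only
  split_ifs <;> first | omega | ring

theorem cum_moveLeft (η : Config N) (i : Fin N) (hi : 0 < η i) (h : 0 < (i : ℕ)) (k : ℕ) :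
    cum (moveLeft η i) k = cum η k + (if k = i then 1 else 0) := by
  rw [moveLeft, if_pos h, cum_move η (by simp [Fin.ext_iff]; omega) hi]
  simp only
  split_ifs <;> first | omega | ring

theorem occ_shift_zero (hN : 1 ≤ N) (η : Config N) : occ (shift η) 0 = occ η 0 + occ η 1 := by
  have : 0 < N := hN
  unfold occ shift
  split_ifs <;> simp_all

theorem occ_shift_succ (η : Config N) (k : ℕ) : occ (shift η) (k + 1) = occ η (k + 2) := by
  unfold occ shift
  split_ifs <;> first | omega | simp_all

theorem cum_shift (hN : 1 ≤ N) (η : Config N) (j : ℕ) :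
    cum (shift η) (j + 1) = cum η (j + 2) := by
  induction j with
  | zero => simp [cum, Finset.sum_range_succ, occ_shift_zero hN]
  | succ j ih => rw [cum_succ, ih, occ_shift_succ, cum_succ η (j + 2)]

/-- The configurations with `N` particles. -/
def level (N : ℕ) : Set (Config N) := {η | ∑ i, η i = N}

theorem mem_level_iff {η : Config N} : η ∈ level N ↔ cum η N = N := by
  rw [cum_eq_sum]
  exact_mod_cast Iff.rfl

theorem finite_level (N : ℕ) : (level N).Finite := by
  refine (Set.finite_Iic (fun _ : Fin N => N)).subset fun η hη i => ?_
  have hη' : ∑ i, η i = N := hη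
  have := Finset.single_le_sum (f := η) (fun _ _ => Nat.zero_le _) (Finset.mem_univ i)
  rwa [hη'] at this

/-- Either the jump rate vanishes or the site is nonempty, so the formulas for moves apply wherever
they carry weight. -/
theorem rho_eq_zero_or (n : ℕ) : (rho n = 0 ∧ n ≤ 1) ∨ (rho n = n - 1 ∧ 2 ≤ n) := by
  rcases Nat.lt_or_ge n 2 with h | h
  · left
    have : (n : ℝ) ≤ 1 := by exact_mod_cast Nat.lt_succ_iff.1 h
    exact ⟨max_eq_right (by linarith), by omega⟩
  · right
    have : (2 : ℝ) ≤ n := by exact_mod_cast h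
    exact ⟨max_eq_left (by linarith), h⟩

theorem rho_nonneg (n : ℕ) : 0 ≤ rho n := le_max_right _ _

theorem rho_le (n : ℕ) : rho n ≤ n := max_le (by linarith) (Nat.cast_nonneg n)

theorem moveRight_mem_level {η : Config N} {i : Fin N} (hi : 0 < η i) :
    moveRight η i ∈ level N ↔ η ∈ level N := by
  by_cases h : (i : ℕ) + 1 < N
  · rw [mem_level_iff, mem_level_iff, cum_moveRight η i hi h, if_neg (by omega), sub_zero]
  · rw [moveRight, dif_neg h]

theorem moveLeft_mem_level {η : Config N} {i : Fin N} (hi : 0 < η i) :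
    moveLeft η i ∈ level N ↔ η ∈ level N := by
  by_cases h : 0 < (i : ℕ)
  · rw [mem_level_iff, mem_level_iff, cum_moveLeft η i hi h, if_neg (by omega), add_zero]
  · rw [moveLeft, if_neg h]

theorem shift_mem_level (hN : 1 ≤ N) {η : Config N} : shift η ∈ level N ↔ η ∈ level N := by
  obtain ⟨n, rfl⟩ : ∃ n, N = n + 1 := ⟨N - 1, by omega⟩
  rw [mem_level_iff, mem_level_iff, cum_shift hN, cum_succ, occ, dif_neg (by omega), add_zero]

/-- The generator acts separately on each particle-number sector. -/
theorem generator_indicator_level (a : ℝ) (hN : 1 ≤ N) (f : Config N → ℝ) (η : Config N) :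
    generator a ((level N).indicator f) η = (level N).indicator (generator a f) η := by
  have key : ∀ i, rho (η i) * (((level N).indicator f (moveLeft η i) - (level N).indicator f η) +
      ((level N).indicator f (moveRight η i) - (level N).indicator f η)) =
      (level N).indicator (fun η => rho (η i) *
        ((f (moveLeft η i) - f η) + (f (moveRight η i) - f η))) η := by
    intro i
    rcases rho_eq_zero_or (η i) with h | h
    · by_cases hη : η ∈ level N <;> simp [h.1, hη]
    · have hi : 0 < η i := by omega
      by_cases hη : η ∈ level N
      · simp [hη, moveLeft_mem_level hi, moveRight_mem_level hi]
      · simp [hη, moveLeft_mem_level hi, moveRight_mem_level hi]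
  unfold generator
  simp only [key]
  by_cases hη : η ∈ level N
  · simp [hη, shift_mem_level hN]
  · simp [hη, shift_mem_level hN]

/-! ### The discrete `H⁻¹` energy and its dissipation. -/

/-- A discrete `H⁻¹` energy of `η - 1`: the mean square of the rescaled current potential. -/
noncomputable def potentialEnergy (η : Config N) : ℝ :=
  (∑ j ∈ Finset.range N, (cum η j - j) ^ 2) / (N : ℝ) ^ 3

theorem potentialEnergy_nonneg (η : Config N) : 0 ≤ potentialEnergy η := by
  unfold potentialEnergy; positivity

theorem potentialEnergy_le_one {η : Config N} (hη : η ∈ level N) : potentialEnergy η ≤ 1 := by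
  refine div_le_one_of_le₀ ?_ (by positivity)
  have : ∀ j ∈ Finset.range N, (cum η j - j) ^ 2 ≤ (N : ℝ) ^ 2 := by
    intro j hj
    have hj' : (j : ℝ) ≤ N := by exact_mod_cast (Finset.mem_range.1 hj).le
    have h1 := cum_mono η (Finset.mem_range.1 hj).le
    rw [mem_level_iff.1 hη] at h1
    have h0 := cum_nonneg η j
    have : (0 : ℝ) ≤ j := Nat.cast_nonneg j
    exact sq_le_sq' (by linarith) (by linarith)
  refine (Finset.sum_le_card_nsmul _ _ _ this).trans ?_
  rw [Finset.card_range, nsmul_eq_mul]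
  exact le_of_eq (by ring)

theorem potentialEnergy_moveRight_sub_le {η : Config N} (hη : η ∈ level N) {i : Fin N}
    (hi : 0 < η i) : potentialEnergy (moveRight η i) - potentialEnergy η ≤
      (1 - 2 * (cum η (i + 1) - (i + 1))) / (N : ℝ) ^ 3 := by
  by_cases h : (i : ℕ) + 1 < N
  · rw [potentialEnergy, potentialEnergy, ← sub_div, ← Finset.sum_sub_distrib]
    refine le_of_eq ?_
    congr 1
    rw [Finset.sum_eq_single ((i : ℕ) + 1)]
    · rw [cum_moveRight η i hi h, if_pos rfl]
      push_cast
      ring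
    · intro k _ hk
      rw [cum_moveRight η i hi h, if_neg hk]
      ring
    · intro h'
      exact (h' (Finset.mem_range.2 h)).elim
  -- At the right wall the move is void, and the bound reads `0 ≤ 1 / N³` because `cum η N = N`.
  · have hN : (i : ℕ) + 1 = N := by omega
    have hN' : (i : ℝ) + 1 = N := by exact_mod_cast hN
    rw [moveRight, dif_neg h, sub_self, hN, mem_level_iff.1 hη, hN', sub_self]
    norm_num

theorem potentialEnergy_moveLeft_sub_le {η : Config N} {i : Fin N}
    (hi : 0 < η i) : potentialEnergy (moveLeft η i) - potentialEnergy η ≤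
      (1 + 2 * (cum η i - i)) / (N : ℝ) ^ 3 := by
  by_cases h : 0 < (i : ℕ)
  · rw [potentialEnergy, potentialEnergy, ← sub_div, ← Finset.sum_sub_distrib]
    refine le_of_eq ?_
    congr 1
    rw [Finset.sum_eq_single (i : ℕ)]
    · rw [cum_moveLeft η i hi h, if_pos rfl]
      ring
    · intro k _ hk
      rw [cum_moveLeft η i hi h, if_neg hk]
      ring
    · intro h'
      exact (h' (Finset.mem_range.2 i.2)).elim
  · have h0 : (i : ℕ) = 0 := by omega
    rw [moveLeft, if_neg h, sub_self, h0, cum_zero]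
    simp

/-- The shift replaces `cum η j` by `cum η (j + 1)` for `j ≥ 1`. The difference of squares factors
as `occ η j` times a sum of two terms, each at most `N`, and the occupation numbers add up to `N`.
-/
theorem potentialEnergy_shift_sub_le (hN : 1 ≤ N) {η : Config N} (hη : η ∈ level N) :
    potentialEnergy (shift η) - potentialEnergy η ≤ 2 * (N : ℝ) ^ 2 / (N : ℝ) ^ 3 := by
  rw [potentialEnergy, potentialEnergy, ← sub_div, ← Finset.sum_sub_distrib]
  gcongr
  have hterm : ∀ j ∈ Finset.range N,
      (cum (shift η) j - j) ^ 2 - (cum η j - j) ^ 2 ≤ occ η j * (2 * N) := by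
    intro j hj
    rcases j with _ | j
    · simp only [cum_zero, sub_self]
      have := occ_nonneg η 0
      positivity
    · have hjN := Finset.mem_range.1 hj
      have h1 := cum_mono η (show j + 2 ≤ N from hjN)
      rw [mem_level_iff.1 hη] at h1
      have h2 := cum_succ η (j + 1)
      have h3 := occ_nonneg η (j + 1)
      rw [cum_shift hN, h2]
      rw [h2] at h1
      have hj0 : (0 : ℝ) ≤ ((j + 1 : ℕ) : ℝ) := Nat.cast_nonneg _
      nlinarith
  refine (Finset.sum_le_sum hterm).trans ?_
  rw [← Finset.sum_mul]
  have : ∑ j ∈ Finset.range N, occ η j = N := mem_level_iff.1 hη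
  rw [this]
  exact le_of_eq (by ring)

/-- The dissipation `N⁻¹ ∑ ρ(η_x)²`. -/
noncomputable def dissipation (η : Config N) : ℝ := (∑ i, rho (η i) ^ 2) / N

theorem dissipation_nonneg (η : Config N) : 0 ≤ dissipation η := by
  unfold dissipation; positivity

/-- Adding the left and right increments at a site leaves `2 - 2 (η_x - 1)`, which is `2 - 2ρ` where
`ρ > 0`. After multiplication by `ρ`, the positive part is at most `2 η_x` and sums to `2N`. -/
theorem generator_potentialEnergy_le {a : ℝ} (ha : 0 ≤ a) (hN : 1 ≤ N) {η : Config N}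
    (hη : η ∈ level N) :
    generator a potentialEnergy η ≤ 2 + 2 * a - 2 * dissipation η := by
  have hN0 : (0 : ℝ) < N := by exact_mod_cast hN
  have hterm : ∀ i : Fin N, rho (η i) * ((potentialEnergy (moveLeft η i) - potentialEnergy η) +
      (potentialEnergy (moveRight η i) - potentialEnergy η)) ≤
      (2 * (η i : ℝ) - 2 * rho (η i) ^ 2) / (N : ℝ) ^ 3 := by
    intro i
    rcases rho_eq_zero_or (η i) with h | h
    · rw [h.1, zero_mul]
      refine div_nonneg ?_ (by positivity)
      simp
    · have hi : 0 < η i := by omega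
      have h1 := potentialEnergy_moveRight_sub_le hη hi
      have h2 := potentialEnergy_moveLeft_sub_le hi
      have h3 := cum_succ η i
      rw [occ_coe] at h3
      rw [h3] at h1
      have h4 : (potentialEnergy (moveLeft η i) - potentialEnergy η) +
          (potentialEnergy (moveRight η i) - potentialEnergy η) ≤
          (2 - 2 * rho (η i)) / (N : ℝ) ^ 3 := by
        refine (add_le_add h2 h1).trans (le_of_eq ?_)
        rw [← add_div, h.1]
        congr 1
        ring
      refine (mul_le_mul_of_nonneg_left h4 (rho_nonneg _)).trans ?_
      rw [mul_div_assoc']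
      gcongr
      nlinarith [rho_le (η i)]
  have hsum := Finset.sum_le_sum fun i (_ : i ∈ Finset.univ) => hterm i
  rw [← Finset.sum_div, Finset.sum_sub_distrib, ← Finset.mul_sum, ← Finset.mul_sum,
    ← cum_eq_sum, mem_level_iff.1 hη] at hsum
  have hshift := potentialEnergy_shift_sub_le hN hη
  calc generator a potentialEnergy η
      ≤ (N : ℝ) ^ 2 * ((2 * N - 2 * ∑ i, rho (η i) ^ 2) / (N : ℝ) ^ 3) +
        a * N * (2 * (N : ℝ) ^ 2 / (N : ℝ) ^ 3) := by
        unfold generator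
        gcongr
    _ = 2 + 2 * a - 2 * dissipation η := by
        unfold dissipation
        field_simp
        ring

end ZeroRange

/-! ### Riemann sums and the energy of empirical measures. -/

/-- Midpoint Riemann sums converge to the integral. -/
theorem tendsto_riemannSum (g : C(I, ℝ)) :
    Tendsto (fun N : ℕ => (∑ i : Fin N, g (ZeroRange.site i)) / N) atTop (𝓝 (∫ x, g x)) := by
  let G : ℝ → ℝ := fun y => g (Set.projIcc 0 1 zero_le_one y)
  have hG : Continuous G := g.continuous.comp continuous_projIcc
  have hint : ∫ x, g x = ∫ y in (0 : ℝ)..1, G y := by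
    rw [intervalIntegral.integral_of_le zero_le_one, ← integral_Icc_eq_integral_Ioc,
      ← integral_subtype measurableSet_Icc]
    refine integral_congr_ae (ae_of_all _ fun x => ?_)
    simp [G]
  have huc : UniformContinuous g := CompactSpace.uniformContinuous_of_continuous g.continuous
  rw [Metric.tendsto_atTop]
  intro ε hε
  obtain ⟨δ, hδ, hgδ⟩ := Metric.uniformContinuous_iff.1 huc (ε / 2) (half_pos hε)
  obtain ⟨N₀, hN₀⟩ := exists_nat_gt (1 / δ)
  refine ⟨N₀ + 1, fun N hN => ?_⟩
  have hNpos : (0 : ℝ) < N := by exact_mod_cast (by omega : 0 < N)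
  have hNδ : 1 / (N : ℝ) < δ := by
    rw [div_lt_comm₀ hNpos hδ]
    exact hN₀.trans_le (by exact_mod_cast (by omega : N₀ ≤ N))
  have hsplit : ∫ y in (0 : ℝ)..1, G y =
      ∑ i : Fin N, ∫ y in ((i : ℕ) : ℝ) / N..(((i : ℕ) + 1 : ℕ) : ℝ) / N, G y := by
    rw [Fin.sum_univ_eq_sum_range (fun k => ∫ y in (k : ℝ) / N..((k + 1 : ℕ) : ℝ) / N, G y) N,
      intervalIntegral.sum_integral_adjacent_intervals (a := fun k : ℕ => (k : ℝ) / N)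
        fun k _ => hG.intervalIntegrable _ _]
    simp [hNpos.ne']
  have hlen : ∀ i : Fin N, (((i : ℕ) + 1 : ℕ) : ℝ) / N - ((i : ℕ) : ℝ) / N = 1 / N := by
    intro i
    push_cast
    ring
  have hcell : ∀ i : Fin N, |g (ZeroRange.site i) / N -
      ∫ y in ((i : ℕ) : ℝ) / N..(((i : ℕ) + 1 : ℕ) : ℝ) / N, G y| ≤ ε / 2 * (1 / N) := by
    intro i
    have hconst : g (ZeroRange.site i) / N =
        ∫ y in ((i : ℕ) : ℝ) / N..(((i : ℕ) + 1 : ℕ) : ℝ) / N, g (ZeroRange.site i) := by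
      rw [intervalIntegral.integral_const, hlen, smul_eq_mul]
      ring
    rw [hconst, ← intervalIntegral.integral_sub (by simp) (hG.intervalIntegrable _ _),
      ← Real.norm_eq_abs]
    refine (intervalIntegral.norm_integral_le_of_norm_le_const fun y hy => ?_).trans_eq
      (by rw [hlen, abs_of_pos (by positivity)])
    rw [Set.uIoc_of_le (by linarith [hlen i, one_div_pos.2 hNpos])] at hy
    rw [← dist_eq_norm]
    refine (hgδ ?_).le
    have hi1 : (((i : ℕ) + 1 : ℕ) : ℝ) ≤ N := by exact_mod_cast i.2
    have hy01 : y ∈ Set.Icc (0 : ℝ) 1 :=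
      ⟨(by positivity : (0 : ℝ) ≤ (i : ℕ) / N).trans hy.1.le,
        hy.2.trans (div_le_one_of_le₀ hi1 hNpos.le)⟩
    rw [Set.projIcc_of_mem _ hy01, Subtype.dist_eq, Real.dist_eq]
    refine lt_of_le_of_lt ?_ hNδ
    have hsite : ((ZeroRange.site i : I) : ℝ) = ((i : ℕ) : ℝ) / N + 1 / N / 2 := by
      simp only [ZeroRange.site]
      field_simp
    have := hlen i
    rw [hsite, abs_le]
    have : 0 < 1 / (N : ℝ) := one_div_pos.2 hNpos
    constructor <;> linarith [hy.1, hy.2]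
  rw [Real.dist_eq, hint, hsplit, Finset.sum_div, ← Finset.sum_sub_distrib]
  refine lt_of_le_of_lt ((Finset.abs_sum_le_sum_abs _ _).trans
    (Finset.sum_le_sum fun i _ => hcell i)) ?_
  rw [Finset.sum_const, Finset.card_univ, Fintype.card_fin, nsmul_eq_mul]
  have : (N : ℝ) * (ε / 2 * (1 / N)) = ε / 2 := by field_simp
  linarith

namespace ZeroRange

variable {N : ℕ}

theorem integral_empirical (η : Config N) (g : C(I, ℝ)) :
    ∫ x, g x ∂(empirical η : Measure I) = (∑ i, (η i : ℝ) * g (site i)) / N := by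
  have : (empirical η : Measure I) =
      ∑ i, ((η i : ℝ≥0) / (N : ℝ≥0)) • Measure.dirac (site i) := by
    rw [empirical, FiniteMeasure.toMeasure_sum]
    rfl
  rw [this, integral_finsetSum_measure fun i _ => ?_, Finset.sum_div]
  · refine Finset.sum_congr rfl fun i _ => ?_
    rw [integral_smul_nnreal_measure, integral_dirac, NNReal.smul_def, smul_eq_mul]
    push_cast
    ring
  · exact Integrable.smul_measure_nnreal (g.continuous.integrable_of_hasCompactSupport
      (HasCompactSupport.of_compactSpace g))

/-- The excess of the Riemann sum of `g²` over its integral, halved. -/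
noncomputable def riemannError (g : C(I, ℝ)) (N : ℕ) : ℝ :=
  ((∑ i : Fin N, g (site i) ^ 2) / N - ∫ x, g x ^ 2) / 2

theorem tendsto_riemannError (g : C(I, ℝ)) : Tendsto (riemannError g) atTop (𝓝 0) := by
  have := ((tendsto_riemannSum (g ^ 2)).sub_const (∫ x, g x ^ 2)).div_const 2
  simp only [ContinuousMap.pow_apply, sub_self, zero_div] at this
  exact this

/-- Sitewise, `η g ≤ η²/2 + g²/2`, and `η ≤ ρ + 1` gives `η²/2 ≤ ρ² + 1`. -/
theorem energyTest_empirical_le {η : Config N} (hN : 1 ≤ N) (g : C(I, ℝ)) :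
    energyTest (empirical η) g ≤ dissipation η + 1 + riemannError g N := by
  have hN0 : (0 : ℝ) < N := by exact_mod_cast hN
  have hterm : ∀ i : Fin N, (η i : ℝ) * g (site i) ≤
      rho (η i) ^ 2 + 1 + g (site i) ^ 2 / 2 := by
    intro i
    have h : (η i : ℝ) - 1 ≤ rho (η i) := le_max_left _ _
    have h0 : (0 : ℝ) ≤ η i := Nat.cast_nonneg _
    nlinarith [sq_nonneg ((η i : ℝ) - g (site i)), sq_nonneg (rho (η i) - 1), rho_nonneg (η i)]
  have hsum := Finset.sum_le_sum fun i (_ : i ∈ Finset.univ) => hterm i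
  rw [Finset.sum_add_distrib, Finset.sum_add_distrib, Finset.sum_const, Finset.card_univ,
    Fintype.card_fin, nsmul_eq_mul, mul_one, ← Finset.sum_div] at hsum
  rw [energyTest, integral_empirical, riemannError, dissipation]
  have := (div_le_div_iff_of_pos_right hN0).2 hsum
  rw [add_div, add_div, div_self hN0.ne', div_right_comm] at this
  linarith

/-! ### The martingale problem and the space-time bound. -/

variable {T a : ℝ}

theorem IsProcessLaw.integral_eq {P : Measure (SkorokhodSpace T (Config N))}
    [IsProbabilityMeasure P] (hP : IsProcessLaw T a N P) {f : Config N → ℝ}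
    (hf : (Function.support f).Finite) (hT : 0 ≤ T) (t : Set.Icc (0 : ℝ) T) :
    Integrable (fun x : SkorokhodSpace T (Config N) =>
      f (x t) - ∫ s in Set.Iic t, generator a f (x s) ∂timeMeasure T) P ∧
    ∫ x, (f (x t) - ∫ s in Set.Iic t, generator a f (x s) ∂timeMeasure T) ∂P =
      ∫ x, f (x ⟨0, le_rfl, hT⟩) ∂P := by
  have hm := hP f hf
  refine ⟨hm.integrable t, ?_⟩
  have h := hm.setIntegral_eq (i := ⟨0, le_rfl, hT⟩) (j := t) t.2.1 MeasurableSet.univ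
  rw [setIntegral_univ, setIntegral_univ] at h
  rw [← h]
  refine integral_congr_ae (ae_of_all _ fun x => ?_)
  have h0 : Set.Iic (⟨0, le_rfl, hT⟩ : Set.Icc (0 : ℝ) T) = {⟨0, le_rfl, hT⟩} :=
    Set.eq_singleton_iff_unique_mem.2 ⟨Set.mem_Iic.2 le_rfl, fun s hs => le_antisymm hs s.2.1⟩
  have hz : ∫ s in Set.Iic (⟨0, le_rfl, hT⟩ : Set.Icc (0 : ℝ) T), generator a f (x s)
      ∂timeMeasure T = 0 := by
    rw [h0]
    exact setIntegral_measure_zero _ (measure_singleton _)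
  simp only [hz, sub_zero]

theorem generator_const (a c : ℝ) (η : Config N) : generator a (fun _ => c) η = 0 := by
  simp [generator]

/-- The indicator of the finite set `level N` is an admissible test function annihilated by the
generator, so its expectation is constant in time. -/
theorem IsProcessLaw.ae_mem_level {P : Measure (SkorokhodSpace T (Config N))}
    [IsProbabilityMeasure P] (hP : IsProcessLaw T a N P) (hN : 1 ≤ N) (hT : 0 ≤ T)
    (h0 : ∀ᵐ x ∂P, x ⟨0, le_rfl, hT⟩ ∈ level N) (t : Set.Icc (0 : ℝ) T) :
    ∀ᵐ x ∂P, x t ∈ level N := by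
  let f : Config N → ℝ := (level N).indicator fun _ => 1
  have hf : (Function.support f).Finite := (finite_level N).subset Set.support_indicator_subset
  have hgen : ∀ η, generator a f η = 0 := fun η => by
    rw [generator_indicator_level a hN]
    simp [generator_const]
  have h := (hP.integral_eq hf hT t).2
  simp only [hgen, integral_zero, sub_zero] at h
  have h1 : ∫ x, f (x ⟨0, le_rfl, hT⟩) ∂P = 1 := by
    rw [integral_congr_ae (g := fun _ => 1) (by filter_upwards [h0] with x hx; simp [f, hx])]
    simp
  rw [h1] at h
  have hmeas : MeasurableSet {x : SkorokhodSpace T (Config N) | x t ∈ level N} :=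
    SkorokhodSpace.measurable_eval t (MeasurableSet.of_discrete)
  have hind : ∀ x : SkorokhodSpace T (Config N),
      f (x t) = {x : SkorokhodSpace T (Config N) | x t ∈ level N}.indicator 1 x := fun x => rfl
  simp only [hind] at h
  rw [integral_indicator_one hmeas] at h
  rw [measureReal_def, ENNReal.toReal_eq_one_iff] at h
  exact (prob_compl_eq_zero_iff hmeas).2 h

theorem IsProcessLaw.ae_forall_mem_level {P : Measure (SkorokhodSpace T (Config N))}
    [IsProbabilityMeasure P] (hP : IsProcessLaw T a N P) (hN : 1 ≤ N) (hT : 0 < T)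
    (h0 : ∀ᵐ x ∂P, x ⟨0, le_rfl, hT.le⟩ ∈ level N) :
    ∀ᵐ x ∂P, ∀ t, x t ∈ level N := by
  obtain ⟨D, hDc, hDd⟩ := TopologicalSpace.exists_countable_dense (Set.Icc (0 : ℝ) T)
  have hD := (ae_ball_iff hDc).2 fun t _ => hP.ae_mem_level hN hT.le h0 t
  filter_upwards [hD, hP.ae_mem_level hN hT.le h0 ⟨T, hT.le, le_rfl⟩] with x hx hxT t
  -- The final time has no times to its right, so right continuity cannot reach it from the dense
  -- set.
  by_cases ht : (t : ℝ) = T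
  · rwa [show t = ⟨T, hT.le, le_rfl⟩ from Subtype.ext ht]
  have htT : (t : ℝ) < T := lt_of_le_of_ne t.2.2 ht
  have hev : ∀ᶠ s in 𝓝[≥] t, x s = x t :=
    (x.right_continuous t).eventually (IsOpen.mem_nhds (isOpen_discrete {x t}) rfl)
  rw [eventually_nhdsWithin_iff, eventually_nhds_iff] at hev
  obtain ⟨U, hU, hUo, htU⟩ := hev
  have hne : (U ∩ Set.Ioi t).Nonempty := by
    have : (𝓝[>] t).NeBot := nhdsGT_neBot_of_exists_gt ⟨⟨T, hT.le, le_rfl⟩, htT⟩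
    exact this.nonempty_of_mem (inter_mem (mem_nhdsWithin_of_mem_nhds (hUo.mem_nhds htU))
      self_mem_nhdsWithin)
  obtain ⟨s, ⟨hsU, hst⟩, hsD⟩ := hDd.inter_open_nonempty _ (hUo.inter isOpen_Ioi) hne
  rw [← hU s hsU (Set.mem_Ici.2 (le_of_lt hst))]
  exact hx s hsD

/-- Dynkin's formula for the energy: the initial value is at most `1`, the final one is nonnegative,
and half the drift bound yields `1 / 2` and `1 + a`. -/
theorem IsProcessLaw.integral_integral_le {P : Measure (SkorokhodSpace T (Config N))}
    [IsProbabilityMeasure P] (hP : IsProcessLaw T a N P) (ha : 0 ≤ a) (hN : 1 ≤ N) (hT : 0 < T)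
    (h0 : ∀ᵐ x ∂P, x ⟨0, le_rfl, hT.le⟩ ∈ level N) {Ψ : Config N → ℝ} {C K : ℝ}
    (hC : ∀ η, |Ψ η| ≤ C) (hΨ : ∀ η ∈ level N, Ψ η ≤ dissipation η + K) :
    ∫ x, ∫ t, Ψ (x t) ∂timeMeasure T ∂P ≤ 1 / 2 + (1 + a + K) * T := by
  -- Cutting off outside `level N` gives the finite support that the martingale problem demands.
  let f : Config N → ℝ := (level N).indicator potentialEnergy
  have hf : (Function.support f).Finite := (finite_level N).subset Set.support_indicator_subset
  have hf0 : ∀ η, 0 ≤ f η := fun η => Set.indicator_nonneg (fun η _ => potentialEnergy_nonneg η) η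
  have hf1 : ∀ η, f η ≤ 1 := fun η => by
    by_cases hη : η ∈ level N
    · simpa [f, hη] using potentialEnergy_le_one hη
    · simp [f, hη]
  have hgenf : ∀ η, generator a f η = (level N).indicator (generator a potentialEnergy) η :=
    generator_indicator_level a hN _
  obtain ⟨B, hB⟩ : ∃ B, ∀ η, |generator a f η| ≤ B := by
    obtain ⟨B, hB⟩ := ((finite_level N).image fun η => |generator a potentialEnergy η|).bddAbove
    refine ⟨max B 0, fun η => ?_⟩
    rw [hgenf]
    by_cases hη : η ∈ level N
    · simpa [hη] using Or.inl (hB (Set.mem_image_of_mem _ hη))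
    · simp [hη]
  obtain ⟨hint, heq⟩ := hP.integral_eq hf hT.le ⟨T, hT.le, le_rfl⟩
  have huniv : Set.Iic (⟨T, hT.le, le_rfl⟩ : Set.Icc (0 : ℝ) T) = Set.univ :=
    Set.eq_univ_of_forall fun s => s.2.2
  simp only [huniv, setIntegral_univ] at hint heq
  have hinit : ∫ x, f (x ⟨0, le_rfl, hT.le⟩) ∂P ≤ 1 := by
    refine (integral_mono_of_nonneg (ae_of_all _ fun _ => hf0 _) (integrable_const 1)
      (ae_of_all _ fun _ => hf1 _)).trans_eq (by simp)
  have hmass : (timeMeasure T).real Set.univ = T := by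
    rw [timeMeasure, measureReal_def, comap_subtype_coe_apply measurableSet_Icc, Set.image_univ,
      Subtype.range_coe, Real.volume_Icc, ENNReal.toReal_ofReal (by linarith), sub_zero]
  have hpath : ∀ᵐ x ∂P, ∫ t, Ψ (x t) ∂timeMeasure T ≤
      (1 + a + K) * T + (f (x ⟨T, hT.le, le_rfl⟩) -
        ∫ s, generator a f (x s) ∂timeMeasure T) / 2 := by
    filter_upwards [hP.ae_forall_mem_level hN hT h0] with x hx
    have i1 := x.integrable_comp_path (continuous_of_discreteTopology (f := generator a f)) hB
    have i2 := x.integrable_comp_path (continuous_of_discreteTopology (f := Ψ)) hC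
    have hle : ∫ t, Ψ (x t) ∂timeMeasure T ≤
        ∫ t, ((1 + a + K) - generator a f (x t) / 2) ∂timeMeasure T := by
      refine integral_mono i2 ((integrable_const _).sub (i1.div_const 2)) fun t => ?_
      have h1 := hΨ _ (hx t)
      have h2 := generator_potentialEnergy_le ha hN (hx t)
      simp only [hgenf, Set.indicator_of_mem (hx t)]
      linarith
    rw [integral_sub (integrable_const _) (i1.div_const 2), integral_const, hmass, smul_eq_mul,
      integral_div] at hle
    linarith [hf0 (x ⟨T, hT.le, le_rfl⟩)]
  have hcont := SkorokhodSpace.continuous_integral_comp (T := T)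
    (continuous_of_discreteTopology (f := Ψ)) hC
  have hbd : ∀ x : SkorokhodSpace T (Config N), ‖∫ t, Ψ (x t) ∂timeMeasure T‖ ≤ C * T := fun x =>
    (norm_integral_le_of_norm_le_const (ae_of_all _ fun t => hC _)).trans_eq (by rw [hmass])
  have := integral_mono_ae (.of_bound hcont.measurable.aestronglyMeasurable (C * T)
    (ae_of_all _ hbd)) ((integrable_const _).add (hint.div_const 2)) hpath
  refine this.trans ?_
  rw [integral_add' (integrable_const _) (hint.div_const 2), integral_div, heq]
  simp only [integral_const, probReal_univ, one_smul]
  linarith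

end ZeroRange

/-! ### Truncated energies along a path. -/

theorem SkorokhodSpace.bddAbove_range {T : ℝ} (x : SkorokhodSpace T ℝ) :
    BddAbove (Set.range x) := by
  rw [← Set.image_univ]
  refine isCompact_univ.induction_on (p := fun s => BddAbove (x '' s)) (by simp)
    (fun s t hst ht => ht.mono (Set.image_mono hst))
    (fun s t hs ht => by rw [Set.image_union]; exact hs.union ht) fun t _ => ?_
  obtain ⟨l, hl⟩ := x.left_limit t
  have h1 : ∀ᶠ s in 𝓝[<] t, x s ≤ max (l + 1) (x t + 1) :=
    (hl.eventually (gt_mem_nhds (lt_add_one l))).mono fun s hs => hs.le.trans (le_max_left _ _)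
  have h2 : ∀ᶠ s in 𝓝[≥] t, x s ≤ max (l + 1) (x t + 1) :=
    ((x.right_continuous t).eventually (gt_mem_nhds (lt_add_one (x t)))).mono
      fun s hs => hs.le.trans (le_max_right _ _)
  have h3 : ∀ᶠ s in 𝓝 t, x s ≤ max (l + 1) (x t + 1) := by
    rw [← nhdsLT_sup_nhdsGE]
    exact eventually_sup.2 ⟨h1, h2⟩
  refine ⟨_, mem_nhdsWithin_of_mem_nhds h3, max (l + 1) (x t + 1), ?_⟩
  rintro _ ⟨s, hs, rfl⟩
  exact hs

/-- The maximum of `energyTest m` over the first `k + 1` test functions, truncated to `[0, k]`. -/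
noncomputable def truncatedEnergy (g : ℕ → C(I, ℝ)) (k : ℕ) (m : FiniteMeasure I) : ℝ :=
  min (k : ℝ) (max 0 ((Finset.range (k + 1)).sup' Finset.nonempty_range_add_one
    fun i => energyTest m (g i)))

section truncatedEnergy

variable (g : ℕ → C(I, ℝ))

theorem truncatedEnergy_nonneg (k : ℕ) (m : FiniteMeasure I) : 0 ≤ truncatedEnergy g k m :=
  le_min (Nat.cast_nonneg k) (le_max_left _ _)

theorem abs_truncatedEnergy_le (k : ℕ) (m : FiniteMeasure I) : |truncatedEnergy g k m| ≤ k := by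
  rw [abs_of_nonneg (truncatedEnergy_nonneg g k m)]
  exact min_le_left _ _

theorem continuous_truncatedEnergy (k : ℕ) : Continuous (truncatedEnergy g k) :=
  continuous_const.min (continuous_const.max
    (Continuous.finset_sup'_apply _ fun i _ => continuous_energyTest_left (g i)))

theorem monotone_truncatedEnergy (m : FiniteMeasure I) :
    Monotone fun k => truncatedEnergy g k m := by
  intro k l hkl
  refine min_le_min (by exact_mod_cast hkl) (max_le_max le_rfl (Finset.sup'_mono _ ?_ _))
  exact Finset.range_mono (by omega)

variable {g}

/-- Once `k > c` the cap at `k` is inactive, and for `k ≥ n` the maximum includes `g n`. -/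
theorem energyTest_le_of_truncatedEnergy_le {m : FiniteMeasure I} {c : ℝ}
    (h : ∀ k, truncatedEnergy g k m ≤ c) (n : ℕ) : energyTest m (g n) ≤ c := by
  obtain ⟨k, hk⟩ := exists_nat_gt c
  have h' := h (max n k)
  rw [truncatedEnergy, min_le_iff, max_le_iff, Finset.sup'_le_iff] at h'
  rcases h' with h' | h'
  · exact absurd (hk.trans_le (by exact_mod_cast le_max_right n k)) (not_lt.2 h')
  · exact h'.2 n (Finset.mem_range.2 (by omega))

theorem eventually_truncatedEnergy_empirical_le (k : ℕ) :
    ∀ᶠ N : ℕ in atTop, ∀ η : ZeroRange.Config N,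
      truncatedEnergy g k (ZeroRange.empirical η) ≤ ZeroRange.dissipation η + 2 := by
  have h : ∀ᶠ N : ℕ in atTop, ∀ i ∈ Finset.range (k + 1), ZeroRange.riemannError (g i) N < 1 := by
    rw [Filter.eventually_all_finset]
    exact fun i _ => (ZeroRange.tendsto_riemannError (g i)).eventually (gt_mem_nhds one_pos)
  filter_upwards [h, eventually_ge_atTop 1] with N hN hN1 η
  refine (min_le_right _ _).trans (max_le ?_ (Finset.sup'_le _ _ fun i hi => ?_))
  · linarith [ZeroRange.dissipation_nonneg η]
  · linarith [ZeroRange.energyTest_empirical_le (η := η) hN1 (g i), hN i hi]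

/-- A path with finite time-integrated energy has an `L²` density. -/
theorem exists_density_of_iSup_truncatedEnergy_lt_top (hg : DenseRange g) {T : ℝ}
    (μ : SkorokhodSpace T (FiniteMeasure I))
    (hμ : ⨆ k, ENNReal.ofReal (∫ t, truncatedEnergy g k (μ t) ∂ZeroRange.timeMeasure T) < ∞) :
    ∃ u : Set.Icc (0 : ℝ) T × I → ℝ,
      Measurable u ∧ (∀ z, 0 ≤ u z) ∧ MemLp u 2 ((ZeroRange.timeMeasure T).prod volume) ∧
      ∀ᵐ t ∂(ZeroRange.timeMeasure T),
        (μ t : Measure I) = volume.withDensity (fun x => ENNReal.ofReal (u (t, x))) := by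
  set c : Set.Icc (0 : ℝ) T → ℝ≥0∞ := fun t => ⨆ k, ENNReal.ofReal (truncatedEnergy g k (μ t))
  have hmeas : ∀ k, Measurable fun t => ENNReal.ofReal (truncatedEnergy g k (μ t)) := fun k =>
    (μ.measurable_comp_path (continuous_truncatedEnergy g k)).ennreal_ofReal
  have hcm : Measurable c := Measurable.iSup hmeas
  have hc : ∫⁻ t, c t ∂ZeroRange.timeMeasure T < ∞ := by
    rw [lintegral_iSup hmeas fun k l hkl t =>
      ENNReal.ofReal_le_ofReal (monotone_truncatedEnergy g (μ t) hkl)]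
    refine lt_of_le_of_lt (le_of_eq ?_) hμ
    congr 1 with k
    rw [ofReal_integral_eq_lintegral_ofReal (μ.integrable_comp_path (continuous_truncatedEnergy g k)
      (abs_truncatedEnergy_le g k)) (ae_of_all _ fun t => truncatedEnergy_nonneg g k _)]
  have hcfin : ∀ᵐ t ∂ZeroRange.timeMeasure T, c t < ∞ := ae_lt_top hcm hc.ne
  have henergy : ∀ t, c t < ∞ → ∀ f : C(I, ℝ), energyTest (μ t) f ≤ (c t).toReal := fun t ht =>
    energyTest_le_of_denseRange hg fun n => energyTest_le_of_truncatedEnergy_le (fun k =>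
      (ENNReal.ofReal_le_iff_le_toReal ht.ne).1
        (le_iSup (fun k => ENNReal.ofReal (truncatedEnergy g k (μ t))) k)) n
  -- Densities chosen separately for each `t` need not be jointly measurable; the derivative of one
  -- kernel against another is.
  let κ : Kernel (Set.Icc (0 : ℝ) T) I := ⟨fun t => (μ t : Measure I),
    measurable_toMeasure_of_forall_integral fun f =>
      μ.measurable_comp_path (FiniteMeasure.continuous_integral_continuousMap f)⟩
  have hκ : IsFiniteKernel κ := by
    obtain ⟨C, hC⟩ := (μ.comp (fun m => (m.mass : ℝ)) (by fun_prop)).bddAbove_range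
    refine ⟨ENNReal.ofReal C, ENNReal.ofReal_lt_top, fun t => ?_⟩
    change (μ t : Measure I) Set.univ ≤ _
    rw [← FiniteMeasure.ennreal_mass, ← ENNReal.ofReal_coe_nnreal]
    exact ENNReal.ofReal_le_ofReal (hC ⟨t, rfl⟩)
  let v : Kernel (Set.Icc (0 : ℝ) T) I := Kernel.const _ volume
  have hw : Measurable fun z : Set.Icc (0 : ℝ) T × I => Kernel.rnDeriv κ v z.1 z.2 :=
    Kernel.measurable_rnDeriv κ v
  have hae : ∀ t, Kernel.rnDeriv κ v t =ᵐ[volume] (μ t : Measure I).rnDeriv volume := fun t =>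
    Kernel.rnDeriv_eq_rnDeriv_measure (κ := κ) (η := v) (a := t)
  refine ⟨fun z => (Kernel.rnDeriv κ v z.1 z.2).toReal, hw.ennreal_toReal,
    fun z => ENNReal.toReal_nonneg, ⟨hw.ennreal_toReal.aestronglyMeasurable, ?_⟩, ?_⟩
  · rw [eLpNorm_lt_top_iff_lintegral_rpow_enorm_lt_top two_ne_zero ENNReal.ofNat_ne_top]
    calc ∫⁻ z, ‖(Kernel.rnDeriv κ v z.1 z.2).toReal‖ₑ ^ (2 : ℝ≥0∞).toReal
          ∂(ZeroRange.timeMeasure T).prod volume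
        ≤ ∫⁻ z, Kernel.rnDeriv κ v z.1 z.2 ^ 2 ∂(ZeroRange.timeMeasure T).prod volume := by
          refine lintegral_mono fun z => ?_
          rw [ENNReal.toReal_ofNat, ENNReal.rpow_ofNat]
          gcongr
          rw [Real.enorm_eq_ofReal ENNReal.toReal_nonneg]
          exact ENNReal.ofReal_toReal_le
      _ = ∫⁻ t, (∫⁻ x, Kernel.rnDeriv κ v t x ^ 2) ∂ZeroRange.timeMeasure T :=
          lintegral_prod _ (hw.pow_const 2).aemeasurable
      _ ≤ ∫⁻ t, 2 * c t ∂ZeroRange.timeMeasure T := by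
          refine lintegral_mono_ae ?_
          filter_upwards [hcfin] with t ht
          refine (lintegral_congr_ae ((hae t).fun_comp (· ^ 2))).trans_le ?_
          refine (lintegral_rnDeriv_sq_le (henergy t ht)).trans_eq ?_
          rw [ENNReal.ofReal_mul two_pos.le, ENNReal.ofReal_toReal ht.ne, ENNReal.ofReal_ofNat]
      _ < ∞ := by
          rw [lintegral_const_mul _ hcm]
          exact ENNReal.mul_lt_top ENNReal.ofNat_lt_top hc
  · filter_upwards [hcfin] with t ht
    rw [← Measure.withDensity_rnDeriv_eq _ _
      (absolutelyContinuous_of_energyTest_le (henergy t ht))]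
    refine withDensity_congr_ae ?_
    filter_upwards [hae t, Measure.rnDeriv_lt_top (μ t : Measure I) volume] with x hx hx'
    rw [hx, ENNReal.ofReal_toReal hx'.ne]

end truncatedEnergy

/-! ### Passage to the limit. -/

theorem lemma2p1 (T a : ℝ) (hT : 0 < T) (ha : 0 ≤ a)
    (P : ∀ N : ℕ, ProbabilityMeasure (SkorokhodSpace T (ZeroRange.Config N)))
    (hP : ∀ N : ℕ, 1 ≤ N → ZeroRange.IsProcessLaw T a N (P N))
    (hinit : ∀ N : ℕ, 1 ≤ N →
      ∀ᵐ x ∂(P N : Measure (SkorokhodSpace T (ZeroRange.Config N))),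
        x ⟨0, le_rfl, hT.le⟩ ∈ ZeroRange.Omega' N)
    (hsup : ⨆ (N : ℕ) (_ : 1 ≤ N),
      ∫⁻ x, ENNReal.ofReal ((1 / (N : ℝ)) * ∑ i, (x ⟨0, le_rfl, hT.le⟩ i : ℝ) ^ 2)
        ∂(P N : Measure (SkorokhodSpace T (ZeroRange.Config N))) < ∞)
    (φ : ℕ → ℕ) (hφ : StrictMono φ)
    (Qlim : ProbabilityMeasure (SkorokhodSpace T (FiniteMeasure I)))
    (hQ : Tendsto (fun k => ZeroRange.empiricalLaw (P (φ k))) atTop (𝓝 Qlim)) :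
    ∀ᵐ μ ∂(Qlim : Measure (SkorokhodSpace T (FiniteMeasure I))),
      ∃ u : Set.Icc (0 : ℝ) T × I → ℝ,
        Measurable u ∧ (∀ z, 0 ≤ u z) ∧ MemLp u 2 ((ZeroRange.timeMeasure T).prod volume) ∧
        ∀ᵐ t ∂(ZeroRange.timeMeasure T),
          (μ t : Measure I) = volume.withDensity (fun x => ENNReal.ofReal (u (t, x))) := by
  let g : ℕ → C(I, ℝ) := TopologicalSpace.denseSeq C(I, ℝ)
  have hg : DenseRange g := TopologicalSpace.denseRange_denseSeq _
  let J : ℕ → SkorokhodSpace T (FiniteMeasure I) → ℝ := fun k μ =>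
    ∫ t, truncatedEnergy g k (μ t) ∂ZeroRange.timeMeasure T
  have hJc : ∀ k, Continuous (J k) := fun k =>
    SkorokhodSpace.continuous_integral_comp (continuous_truncatedEnergy g k)
      (abs_truncatedEnergy_le g k)
  have hJ0 : ∀ k μ, 0 ≤ J k μ := fun k μ =>
    integral_nonneg fun t => truncatedEnergy_nonneg g k _
  have hJb : ∀ k μ, ‖J k μ‖ ≤ k * (ZeroRange.timeMeasure T).real Set.univ := fun k μ =>
    norm_integral_le_of_norm_le_const (ae_of_all _ fun t => abs_truncatedEnergy_le g k _)
  have hJi : ∀ k, Integrable (J k) (Qlim : Measure (SkorokhodSpace T (FiniteMeasure I))) :=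
    fun k => .of_bound (hJc k).measurable.aestronglyMeasurable _ (ae_of_all _ (hJb k))
  -- The bound does not depend on `k`. The `2` is the `1` from Young's inequality plus a Riemann
  -- error below `1`, valid once `N` is large depending on `k`.
  have hbound : ∀ k, ∫ μ, J k μ ∂(Qlim : Measure (SkorokhodSpace T (FiniteMeasure I))) ≤
      1 / 2 + (1 + a + 2) * T := by
    intro k
    have hlim := ProbabilityMeasure.tendsto_iff_forall_integral_tendsto.1 hQ
      (BoundedContinuousFunction.ofNormedAddCommGroup (J k) (hJc k) _ (hJb k))
    refine le_of_tendsto hlim ?_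
    filter_upwards [hφ.tendsto_atTop.eventually
      (eventually_truncatedEnergy_empirical_le (g := g) k),
      hφ.tendsto_atTop.eventually (eventually_ge_atTop 1)] with n hn hn1
    simp only [BoundedContinuousFunction.coe_ofNormedAddCommGroup]
    rw [ZeroRange.empiricalLaw, ProbabilityMeasure.toMeasure_map,
      integral_map (SkorokhodSpace.continuous_comp _ _).measurable.aemeasurable
        (hJc k).measurable.aestronglyMeasurable]
    refine (hP _ hn1).integral_integral_le ha hn1 hT ?_ (C := k)
      (fun η => abs_truncatedEnergy_le g k (ZeroRange.empirical η)) fun η _ => hn η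
    filter_upwards [hinit _ hn1] with x hx
    exact hx.1
  have hfin : ∫⁻ μ, ⨆ k, ENNReal.ofReal (J k μ)
      ∂(Qlim : Measure (SkorokhodSpace T (FiniteMeasure I))) < ∞ := by
    rw [lintegral_iSup fun k => (hJc k).measurable.ennreal_ofReal]
    · refine lt_of_le_of_lt (iSup_le fun k => ?_)
        (ENNReal.ofReal_lt_top (r := 1 / 2 + (1 + a + 2) * T))
      rw [← ofReal_integral_eq_lintegral_ofReal (hJi k) (ae_of_all _ (hJ0 k))]
      exact ENNReal.ofReal_le_ofReal (hbound k)
    · intro k l hkl μ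
      exact ENNReal.ofReal_le_ofReal (integral_mono
        (μ.integrable_comp_path (continuous_truncatedEnergy g k) (abs_truncatedEnergy_le g k))
        (μ.integrable_comp_path (continuous_truncatedEnergy g l) (abs_truncatedEnergy_le g l))
        fun t => monotone_truncatedEnergy g (μ t) hkl)
  filter_upwards [ae_lt_top (Measurable.iSup fun k => (hJc k).measurable.ennreal_ofReal) hfin.ne]
    with μ hμ
  exact exists_density_of_iSup_truncatedEnergy_lt_top hg μ hμ
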